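/- Conventions. All ultrafilters are non-principal ultrafilters over countable index sets $I$. Given metric spaces $(X_n,\mathrm{dist}_n)_{n\in I}$, an ultrafilter $\omega$ over $I$ and an observation point $e=(e_n)\in\prod_n X_n$, the ultralimit $\lim^\omega(X_n,\mathrm{dist}_n)_e$ is the metric space obtained from the set of all sequences $(x_n)\in\prod_n X_n$ with $\lim_\omega \mathrm{dist}_n(x_n,e_n)<\infty$, with the pseudo-metric $D(x,y)=\lim_\omega \mathrm{dist}_n(x_n,y_n)$, by identifying $x$ and $y$ whenever $D(x,y)=0$. An asymptotic cone of a metric space $(X,\mathrm{dist})$ is an ultralimit $\lim^\omega(X,\frac1{d_n}\mathrm{dist})_e$, where $d_n>0$ are scaling constants with $\lim_\omega d_n=\infty$ and $e\in X^I$ is arbitrary. A point of a space is a (global) cut-point if its complement is not connected; by convention a one-point space has a cut-point. A finitely generated group is regarded as a metric space with the word metric $\mathrm{dist}_S(a,b)=|a^{-1}b|_S$ of a finite generating set $S$. A group is virtually cyclic if it has a cyclic subgroup of finite index. Theorem. (1) Let $G$ be a finitely generated group that is not virtually cyclic and has a central infinite cyclic subgroup. Then $G$ is wide: for every finite generating set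 $S$ of $G$, no asymptotic cone of $(G,\mathrm{dist}_S)$ has a cut-point. (2) Let $\mathcal G$ be the family of all finitely generated groups that are not virtually cyclic and have a central infinite cyclic subgroup, each endowed with any of its word metrics with respect to finite generating sets. Then $\mathcal G$ is uniformly unconstricted: for every sequence $(G_n,\mathrm{dist}_n)_{n\in I}$ of members of $\mathcal G$, indexed by a countably infinite set $I$, there exist an ultrafilter $\omega$ over $I$ and scaling constants $d_n>0$ with $\lim_\omega d_n=\infty$ such that for every sequence of base-points $b_n\in G_n$ the ultralimit $\lim^\omega(G_n,\frac1{d_n}\mathrm{dist}_n)_b$ has no cut-point. -/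

import Mathlib

open Filter Topology

universe u

noncomputable section

namespace AsympCone

/-! ### Ultralimits of metric spaces -/

/-- Non-principal ultrafilters: no finite set belongs to `ω`. -/
def NonPrincipal {I : Type} (ω : Ultrafilter I) : Prop :=
  ∀ s : Set I, s.Finite → s ∉ ω

/-- Sequences at finite distance from the observation point `e`: the `ω`-limit of
`dist (x i) (e i)` in `[0, ∞]` is finite exactly when these distances are `ω`-almost surely
bounded by a constant. -/
def FiniteSeq {I : Type} (ω : Ultrafilter I) (X : I → Type u) [∀ i, MetricSpace (X i)]
    (e : ∀ i, X i) : Type u :=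
  {x : ∀ i, X i // ∃ C : ℝ, ∀ᶠ i in (ω : Filter I), dist (x i) (e i) ≤ C}

section

variable {I : Type} {ω : Ultrafilter I} {X : I → Type u} [∀ i, MetricSpace (X i)] {e : ∀ i, X i}

/-- `D(x, y) = lim_ω dist (x i) (y i)`. -/
def ultraDist (x y : FiniteSeq ω X e) : ℝ :=
  limUnder (ω : Filter I) fun i => dist (x.1 i) (y.1 i)

/-- The limit defining `ultraDist` exists. -/
theorem tendsto_ultraDist (x y : FiniteSeq ω X e) :
    Tendsto (fun i => dist (x.1 i) (y.1 i)) (ω : Filter I) (𝓝 (ultraDist x y)) := by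
  obtain ⟨C, hC⟩ := x.2
  obtain ⟨C', hC'⟩ := y.2
  have h : ∀ᶠ i in (ω : Filter I), dist (x.1 i) (y.1 i) ∈ Set.Icc (0 : ℝ) (C + C') := by
    filter_upwards [hC, hC'] with i h1 h2
    exact ⟨dist_nonneg, (dist_triangle_right _ _ (e i)).trans (add_le_add h1 h2)⟩
  obtain ⟨a, -, ha⟩ := isCompact_Icc.ultrafilter_le_nhds
    (ω.map fun i => dist (x.1 i) (y.1 i)) (le_principal_iff.2 h)
  exact tendsto_nhds_limUnder ⟨a, ha⟩

instance : PseudoMetricSpace (FiniteSeq ω X e) where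
  dist := ultraDist
  dist_self x := by
    refine tendsto_nhds_unique (tendsto_ultraDist x x) ?_
    simp
  dist_comm x y := by
    refine tendsto_nhds_unique (tendsto_ultraDist x y) ?_
    simpa only [dist_comm] using tendsto_ultraDist y x
  dist_triangle x y z :=
    le_of_tendsto_of_tendsto' (tendsto_ultraDist x z)
      ((tendsto_ultraDist x y).add (tendsto_ultraDist y z)) fun _ => dist_triangle _ _ _

end

/-- The `ω`-limit of the metric spaces `X i` relative to the observation point `e`: sequences
at finite distance from `e`, two sequences being identified when `D(x, y) = 0`. (Sequences which
agree `ω`-almost surely have `D(x, y) = 0`.) -/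
abbrev Ultralimit {I : Type} (ω : Ultrafilter I) (X : I → Type u) [∀ i, MetricSpace (X i)]
    (e : ∀ i, X i) : Type u :=
  SeparationQuotient (FiniteSeq ω X e)

/-- The metric space `(X, dist / d)`. -/
def Rescaled (X : Type u) (_d : {r : ℝ // 0 < r}) : Type u := X

/-- A point of `X`, seen in `(X, dist / d)`. -/
def Rescaled.mk {X : Type u} (d : {r : ℝ // 0 < r}) (x : X) : Rescaled X d := x

instance (X : Type u) [MetricSpace X] (d : {r : ℝ // 0 < r}) : MetricSpace (Rescaled X d) where
  dist x y := dist (α := X) x y / d.1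
  dist_self x := div_eq_zero_iff.2 (Or.inl (dist_self (α := X) x))
  dist_comm x y := congrArg (· / d.1) (dist_comm (α := X) x y)
  dist_triangle x y z := by
    rw [← add_div]
    exact div_le_div_of_nonneg_right (dist_triangle (α := X) x y z) d.2.le
  eq_of_dist_eq_zero {x y} h := by
    rcases div_eq_zero_iff.1 h with h | h
    · exact eq_of_dist_eq_zero (γ := X) h
    · exact absurd h d.2.ne'

/-- The `ω`-limit of the rescaled spaces `(X i, dist / d i)` with respect to `e`. -/
abbrev ScaledUltralimit {I : Type} (ω : Ultrafilter I) (X : I → Type u) [∀ i, MetricSpace (X i)]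
    (e : ∀ i, X i) (d : I → {r : ℝ // 0 < r}) : Type u :=
  Ultralimit ω (fun i => Rescaled (X i) (d i)) fun i => Rescaled.mk (d i) (e i)

/-- The asymptotic cone of `X` with respect to `ω`, the observation point `e` and the scaling
constants `d`. -/
abbrev Cone {I : Type} (ω : Ultrafilter I) (X : Type u) [MetricSpace X]
    (e : I → X) (d : I → {r : ℝ // 0 < r}) : Type u :=
  ScaledUltralimit ω (fun _ => X) e d

/-- The scaling constants tend to infinity along `ω`. -/
def ScalingTendsto {I : Type} (ω : Ultrafilter I) (d : I → {r : ℝ // 0 < r}) : Prop :=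
  Tendsto (fun i => (d i : ℝ)) (ω : Filter I) atTop

/-! ### Cut-points, wide spaces, uniformly unconstricted families -/

/-- A space has a (global) cut-point if removing some point disconnects it; by convention,
a one-point space has a cut-point. -/
def HasCutPoint (Y : Type u) [TopologicalSpace Y] : Prop :=
  Subsingleton Y ∨ ∃ y : Y, ¬ IsPreconnected ({y}ᶜ : Set Y)

/-- A metric space is wide if none of its asymptotic cones has a cut-point. -/
def Wide (X : Type u) [MetricSpace X] : Prop :=
  ∀ (I : Type) [Countable I] (ω : Ultrafilter I), NonPrincipal ω →
    ∀ d : I → {r : ℝ // 0 < r}, ScalingTendsto ω d →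
      ∀ e : I → X, ¬ HasCutPoint (Cone ω X e d)

/-- A bundled metric space. -/
structure MetricSp : Type (u + 1) where
  carrier : Type u
  [metric : MetricSpace carrier]

instance (B : MetricSp.{u}) : MetricSpace B.carrier := B.metric

/-- A family of metric spaces is uniformly unconstricted if for every sequence in the family
there are an ultrafilter and scaling constants such that, for every choice of base-points, the
ultralimit of the rescaled spaces has no cut-point. -/
def UniformlyUnconstricted (𝓑 : Set MetricSp.{u}) : Prop :=
  ∀ (I : Type) [Countable I] [Infinite I] (B : I → MetricSp.{u}), (∀ i, B i ∈ 𝓑) →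
    ∃ ω : Ultrafilter I, NonPrincipal ω ∧
      ∃ d : I → {r : ℝ // 0 < r}, ScalingTendsto ω d ∧
        ∀ b : ∀ i, (B i).carrier,
          ¬ HasCutPoint (ScaledUltralimit ω (fun i => (B i).carrier) b d)

/-! ### Finitely generated groups as metric spaces -/

section Word

variable {G : Type u} [Group G]

/-- `l` is a group word in `S` (a word in `S ∪ S⁻¹`) which represents `g`. -/
def IsWordFor (S : Set G) (g : G) (l : List G) : Prop :=
  (∀ x ∈ l, x ∈ S ∨ x⁻¹ ∈ S) ∧ l.prod = g

/-- The length of a shortest group word in `S` representing `g`. -/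
def wordLength (S : Set G) (g : G) : ℕ :=
  sInf {n : ℕ | ∃ l : List G, IsWordFor S g l ∧ l.length = n}

theorem exists_word {S : Set G} (hS : Subgroup.closure S = ⊤) (g : G) :
    ∃ l : List G, IsWordFor S g l ∧ l.length = wordLength S g := by
  have hne : {n : ℕ | ∃ l : List G, IsWordFor S g l ∧ l.length = n}.Nonempty := by
    have hg : g ∈ (Subgroup.closure S).toSubmonoid := hS ▸ Subgroup.mem_top g
    rw [Subgroup.closure_toSubmonoid] at hg
    obtain ⟨l, hl, hp⟩ := Submonoid.exists_list_of_mem_closure hg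
    exact ⟨l.length, l, ⟨hl, hp⟩, rfl⟩
  exact Nat.sInf_mem hne

theorem wordLength_le {S : Set G} {g : G} {l : List G} (h : IsWordFor S g l) :
    wordLength S g ≤ l.length :=
  Nat.sInf_le ⟨l, h, rfl⟩

theorem wordLength_inv_le {S : Set G} (hS : Subgroup.closure S = ⊤) (g : G) :
    wordLength S g⁻¹ ≤ wordLength S g := by
  obtain ⟨l, ⟨hl, hp⟩, hn⟩ := exists_word hS g
  have h : IsWordFor S g⁻¹ (l.map fun x => x⁻¹).reverse := by
    refine ⟨fun x hx => ?_, by rw [← List.prod_inv_reverse, hp]⟩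
    obtain ⟨y, hy, rfl⟩ := List.mem_map.1 (List.mem_reverse.1 hx)
    rw [inv_inv]
    exact (hl y hy).symm
  have := wordLength_le h
  rw [List.length_reverse, List.length_map, hn] at this
  exact this

theorem wordLength_mul_le {S : Set G} (hS : Subgroup.closure S = ⊤) (g h : G) :
    wordLength S (g * h) ≤ wordLength S g + wordLength S h := by
  obtain ⟨l, ⟨hl, hp⟩, hn⟩ := exists_word hS g
  obtain ⟨l', ⟨hl', hp'⟩, hn'⟩ := exists_word hS h
  have : IsWordFor S (g * h) (l ++ l') := by
    refine ⟨fun x hx => ?_, by rw [List.prod_append, hp, hp']⟩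
    rcases List.mem_append.1 hx with hx | hx
    · exact hl x hx
    · exact hl' x hx
  have := wordLength_le this
  rw [List.length_append, hn, hn'] at this
  exact this

/-- The word metric on a group with respect to a generating set `S`:
`dist a b` is the word length of `a⁻¹ * b`. -/
@[reducible] def wordMetric (S : Set G) (hS : Subgroup.closure S = ⊤) : MetricSpace G where
  dist a b := wordLength S (a⁻¹ * b)
  dist_self a := by
    have h : wordLength S (1 : G) ≤ 0 := wordLength_le (l := []) ⟨by simp, rfl⟩
    simpa using h
  dist_comm a b := by
    have h1 := wordLength_inv_le hS (a⁻¹ * b)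
    have h2 := wordLength_inv_le hS (b⁻¹ * a)
    rw [mul_inv_rev, inv_inv] at h1 h2
    exact_mod_cast le_antisymm h2 h1
  dist_triangle a b c := by
    have h := wordLength_mul_le hS (a⁻¹ * b) (b⁻¹ * c)
    rw [mul_assoc, mul_inv_cancel_left] at h
    exact_mod_cast h
  eq_of_dist_eq_zero {a b} h := by
    have h0 : wordLength S (a⁻¹ * b) = 0 := by exact_mod_cast h
    obtain ⟨l, ⟨-, hp⟩, hn⟩ := exists_word hS (a⁻¹ * b)
    rw [h0, List.length_eq_zero_iff] at hn
    subst hn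
    rw [List.prod_nil] at hp
    exact (inv_mul_eq_one.1 hp.symm)

end Word

/-- A group is virtually cyclic if it has a cyclic subgroup of finite index. -/
def VirtuallyCyclic (G : Type u) [Group G] : Prop :=
  ∃ H : Subgroup G, IsCyclic H ∧ H.FiniteIndex

/-- The group has a central infinite cyclic subgroup. -/
def HasCentralInfiniteCyclic (G : Type u) [Group G] : Prop :=
  ∃ H : Subgroup G, H ≤ Subgroup.center G ∧ IsCyclic H ∧ Infinite H

/-- A finitely generated group is wide if it is wide for the word metric of every finite
generating set. -/
def WideGroup (G : Type u) [Group G] : Prop :=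
  ∀ (S : Set G) (_ : S.Finite) (hS : Subgroup.closure S = ⊤), @Wide G (wordMetric S hS)

/-- The family of all finitely generated groups which are not virtually cyclic and have a central
infinite cyclic subgroup, each equipped with any of its word metrics with respect to finite
generating sets. -/
def centralFamily : Set MetricSp.{u} :=
  {B | ∃ (G : Type u) (_ : Group G) (S : Set G) (_ : S.Finite)
      (hS : Subgroup.closure S = ⊤),
      ¬ VirtuallyCyclic G ∧ HasCentralInfiniteCyclic G ∧
        B = @MetricSp.mk G (wordMetric S hS)}

end AsympCone

end

namespace AsympCone

/-! ### A criterion for the absence of cut-points -/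

/-! Word metrics are left-invariant, so right multiplication by a central element `h` is an isometry
moving every point by exactly `|h|`. If central elements `a i` of infinite order satisfy `|a i| / d
i → 0`, suitable powers of them have rescaled length tending to any given `r > 0`. The ultralimit is
geodesic and thus carries invertible isometries of every constant displacement.

If `p` were a cut-point, geodesics between the two sides would pass through `p`, and equality in the
triangle inequality would force every point near `p` into the orbit of `p` under these isometries
(`HasGeodesics.eq_or_eq_of_separates`). Yet the group generated by `a i` has infinite index, so it
has minimal coset representatives of every length (`exists_wordLength_eq_of_not_finiteIndex`); these
give points arbitrarily near `p` outside its orbit.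

For a single group `a` is fixed and its length is negligible; for a sequence of groups, `d` is
chosen to dominate the lengths. -/

/-- Any two points are joined by a path parametrized proportionally to arc length. -/
def HasGeodesics (C : Type u) [MetricSpace C] : Prop :=
  ∀ x y : C, ∃ γ : ℝ → C, γ 0 = x ∧ γ 1 = y ∧ ∀ s t, dist (γ s) (γ t) ≤ |s - t| * dist x y

section Criterion

variable {C : Type u} [MetricSpace C]

/-- A geodesic contains a point at any prescribed intermediate distance. -/
theorem HasGeodesics.exists_between (hC : HasGeodesics C) (x y : C) {R : ℝ} (h0 : 0 ≤ R)
    (hR : R ≤ dist x y) : ∃ z, dist x z = R ∧ dist z y = dist x y - R := by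
  obtain ⟨γ, rfl, rfl, hγ⟩ := hC x y
  rcases eq_or_lt_of_le (dist_nonneg (x := γ 0) (y := γ 1)) with hD | hD
  · refine ⟨γ 0, ?_, ?_⟩
    · rw [dist_self]; linarith
    · linarith
  · have hq : 0 ≤ R / dist (γ 0) (γ 1) := by positivity
    have hq1 : R / dist (γ 0) (γ 1) ≤ 1 := (div_le_one hD).2 hR
    have hm : R / dist (γ 0) (γ 1) * dist (γ 0) (γ 1) = R := div_mul_cancel₀ _ hD.ne'
    have h1 := hγ 0 (R / dist (γ 0) (γ 1))
    have h2 := hγ (R / dist (γ 0) (γ 1)) 1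
    rw [zero_sub, abs_neg, abs_of_nonneg hq, hm] at h1
    rw [abs_sub_comm, abs_of_nonneg (sub_nonneg.2 hq1), sub_mul, hm, one_mul] at h2
    have h3 := dist_triangle (γ 0) (γ (R / dist (γ 0) (γ 1))) (γ 1)
    exact ⟨_, by linarith, by linarith⟩

/-- A point separating `x` from `y` lies on the geodesics from `x` to `y`. -/
theorem HasGeodesics.dist_add_dist_of_separates (hC : HasGeodesics C) {p : C} {U V : Set C}
    (hU : IsOpen U) (hV : IsOpen V) (hcov : {p}ᶜ ⊆ U ∪ V) (hdisj : ¬ ({p}ᶜ ∩ (U ∩ V)).Nonempty)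
    {x y : C} (hx : x ∈ U) (hy : y ∈ V) : dist x y = dist x p + dist p y := by
  obtain ⟨γ, rfl, rfl, hγ⟩ := hC x y
  have hcont : Continuous γ :=
    (LipschitzWith.of_dist_le_mul (K := ⟨dist (γ 0) (γ 1), dist_nonneg⟩) fun s t => by
      rw [Real.dist_eq, mul_comm]; exact hγ s t).continuous
  obtain ⟨t, ⟨ht0, ht1⟩, rfl⟩ : ∃ t ∈ Set.Icc (0 : ℝ) 1, γ t = p := by
    by_contra! hp
    have hpre : IsPreconnected (γ '' Set.Icc 0 1) :=
      isPreconnected_Icc.image _ hcont.continuousOn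
    have hsub : γ '' Set.Icc 0 1 ⊆ {p}ᶜ := by
      rintro _ ⟨t, ht, rfl⟩
      exact hp t ht
    obtain ⟨z, hz, hzUV⟩ := hpre U V hU hV (hsub.trans hcov)
      ⟨γ 0, ⟨0, by simp, rfl⟩, hx⟩ ⟨γ 1, ⟨1, by simp, rfl⟩, hy⟩
    exact hdisj ⟨z, hsub hz, hzUV⟩
  have h1 := hγ 0 t
  have h2 := hγ t 1
  rw [zero_sub, abs_neg, abs_of_nonneg ht0] at h1
  rw [abs_sub_comm, abs_of_nonneg (sub_nonneg.2 ht1)] at h2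
  have h3 := dist_triangle (γ 0) (γ t) (γ 1)
  linarith

/-- If `p` separates `x` from its image under an isometry of constant displacement `dist x p`,
then this isometry maps `x` to `p`. -/
theorem HasGeodesics.map_eq_of_separates (hC : HasGeodesics C) {p : C} {U V : Set C}
    (hU : IsOpen U) (hV : IsOpen V) (hcov : {p}ᶜ ⊆ U ∪ V) (hdisj : ¬ ({p}ᶜ ∩ (U ∩ V)).Nonempty)
    {φ : C → C} (hφ : Isometry φ) {x : C} (hdispl : ∀ z, dist z (φ z) = dist x p)
    (hx : x ∈ U) (hp : φ p ∈ V) : φ x = p := by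
  by_contra hne
  -- Either way `p` lies between two points at distance `dist x p`, and one of the two pieces
  -- already has that length, so the other is zero.
  rcases hcov hne with h | h
  · have h1 := hC.dist_add_dist_of_separates hU hV hcov hdisj h hp
    rw [hφ.dist_eq, hdispl] at h1
    exact hne (dist_eq_zero.1 (by linarith))
  · have h1 := hC.dist_add_dist_of_separates hU hV hcov hdisj hx h
    rw [hdispl] at h1
    exact hne (dist_eq_zero.1 (by rw [dist_comm]; linarith))

/-- If `p` separates a geodesic space, then the points close to `p`, on a given side, belong to
the orbit of `p` under isometries of constant displacement. -/
theorem HasGeodesics.eq_or_eq_of_separates (hC : HasGeodesics C) {p : C} {U V : Set C}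
    (hU : IsOpen U) (hV : IsOpen V) (hcov : {p}ᶜ ⊆ U ∪ V) (hdisj : ¬ ({p}ᶜ ∩ (U ∩ V)).Nonempty)
    {x y : C} (hx : x ∈ U) (hxp : x ≠ p) (hy : y ∈ V) (hxy : dist p x ≤ dist p y)
    {φ ψ : C → C} (hφ : Isometry φ) (hφψ : ∀ z, φ (ψ z) = z) (hψφ : ∀ z, ψ (φ z) = z)
    (hdispl : ∀ z, dist z (φ z) = dist x p) : φ p = x ∨ ψ p = x := by
  have hψ : Isometry ψ := Isometry.of_dist_eq fun a b => by
    rw [← hφ.dist_eq, hφψ, hφψ]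
  have hdispl' : ∀ z, dist z (ψ z) = dist x p := fun z => by
    have := hdispl (ψ z)
    rwa [hφψ, dist_comm] at this
  have hR : 0 < dist x p := dist_pos.2 hxp
  have hne : φ p ≠ p := fun h => by
    have := hdispl p
    rw [h, dist_self] at this
    exact hR.ne this
  -- If `φ p` is across from `x`, then `φ x = p`. If it is on the side of `x`, a point `z` across at
  -- the same distance gives `ψ p = z`, and the same argument applies to `ψ`.
  rcases hcov hne with hpU | hpV
  · obtain ⟨z, hz1, hz2⟩ := hC.exists_between p y dist_nonneg hxy
    rw [dist_comm p x] at hz1 hz2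
    have hzp : z ≠ p := by rintro rfl; rw [dist_self] at hz1; exact hR.ne hz1
    -- Otherwise `p` would lie between `z` and `y`, making `dist z y` exceed `dist p y`.
    have hzV : z ∈ V := by
      refine (hcov hzp).resolve_left fun hzU => ?_
      have := hC.dist_add_dist_of_separates hU hV hcov hdisj hzU hy
      rw [dist_comm z p] at this
      linarith
    have hφz : φ z = p := hC.map_eq_of_separates hV hU (by rwa [Set.union_comm])
      (by rwa [Set.inter_comm V U]) hφ (fun w => by rw [hdispl, dist_comm z p, hz1]) hzV hpU
    have hψp : ψ p = z := by rw [← hφz, hψφ]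
    have h2 := hC.map_eq_of_separates hU hV hcov hdisj hψ hdispl' hx (hψp ▸ hzV)
    left
    rw [← h2, hφψ]
  · right
    rw [← hC.map_eq_of_separates hU hV hcov hdisj hφ hdispl hx hpV, hψφ]

/-- A geodesic space has no cut-point as soon as it has bijective isometries of every constant
positive displacement whose orbits contain no ball. -/
theorem not_hasCutPoint_of_displacements [Nonempty C] (hC : HasGeodesics C) (F : Set (C → C))
    (hiso : ∀ φ ∈ F, Isometry φ)
    (hinv : ∀ φ ∈ F, ∃ ψ ∈ F, (∀ z, φ (ψ z) = z) ∧ ∀ z, ψ (φ z) = z)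
    (hdispl : ∀ r : ℝ, 0 < r → ∃ φ ∈ F, ∀ z, dist z (φ z) = r)
    (horbit : ∀ (p : C) (ε : ℝ), 0 < ε → ∃ x, x ≠ p ∧ dist p x ≤ ε ∧ ∀ φ ∈ F, φ p ≠ x) :
    ¬ HasCutPoint C := by
  rintro (hsub | ⟨p, hp⟩)
  · obtain ⟨φ, -, hφ⟩ := hdispl 1 one_pos
    obtain ⟨z⟩ := ‹Nonempty C›
    have := hφ z
    rw [Subsingleton.elim (φ z) z, dist_self] at this
    exact zero_ne_one this
  · rw [IsPreconnected] at hp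
    push Not at hp
    obtain ⟨U, V, hU, hV, hcov, ⟨u, hup, hu⟩, ⟨v, hvp, hv⟩, hdisj⟩ := hp
    rw [← Set.not_nonempty_iff_eq_empty] at hdisj
    -- Whichever side contains `x`, the other side has a point at least as far from `p`.
    obtain ⟨x, hxp, hxε, hxF⟩ := horbit p (min (dist p u) (dist p v))
      (lt_min (dist_pos.2 (Ne.symm hup)) (dist_pos.2 (Ne.symm hvp)))
    obtain ⟨φ, hφF, hφ⟩ := hdispl (dist x p) (dist_pos.2 hxp)
    obtain ⟨ψ, hψF, hφψ, hψφ⟩ := hinv φ hφF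
    have key : φ p = x ∨ ψ p = x := by
      rcases hcov hxp with hx | hx
      · exact hC.eq_or_eq_of_separates hU hV hcov hdisj hx hxp hv
          (hxε.trans (min_le_right _ _)) (hiso φ hφF) hφψ hψφ hφ
      · exact hC.eq_or_eq_of_separates hV hU (by rwa [Set.union_comm])
          (by rwa [Set.inter_comm V U]) hx hxp hu
          (hxε.trans (min_le_left _ _)) (hiso φ hφF) hφψ hψφ hφ
    exact key.elim (hxF φ hφF) (hxF ψ hψF)

end Criterion

/-! ### Word length -/

section WordLength

variable {G : Type u} [Group G] {S : Set G}

theorem wordLength_one : wordLength S (1 : G) = 0 :=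
  Nat.le_zero.1 (wordLength_le (l := []) ⟨by simp, rfl⟩)

theorem wordLength_inv (hS : Subgroup.closure S = ⊤) (g : G) :
    wordLength S g⁻¹ = wordLength S g := by
  refine le_antisymm (wordLength_inv_le hS g) ?_
  simpa using wordLength_inv_le hS g⁻¹

/-- The prefixes of a geodesic word from `1` to `g`. -/
theorem exists_geodesic (hS : Subgroup.closure S = ⊤) (g : G) :
    ∃ u : ℕ → G, u 0 = 1 ∧ u (wordLength S g) = g ∧
      ∀ m n, m ≤ n → wordLength S ((u m)⁻¹ * u n) ≤ n - m := by
  obtain ⟨l, ⟨hl, hp⟩, hn⟩ := exists_word hS g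
  refine ⟨fun m => (l.take m).prod, by simp, by simp [← hn, hp], fun m n hmn => ?_⟩
  have hsplit : l.take n = l.take m ++ (l.drop m).take (n - m) := by
    rw [← List.take_add, Nat.add_sub_cancel' hmn]
  have hw : IsWordFor S ((l.take m).prod⁻¹ * (l.take n).prod) ((l.drop m).take (n - m)) := by
    refine ⟨fun x hx => hl x (List.mem_of_mem_drop (List.mem_of_mem_take hx)), ?_⟩
    rw [hsplit, List.prod_append, inv_mul_cancel_left]
  exact (wordLength_le hw).trans (List.length_take_le _ _)

theorem finite_wordLength_le (hfin : S.Finite) (hS : Subgroup.closure S = ⊤) (n : ℕ) :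
    {g : G | wordLength S g ≤ n}.Finite := by
  have hT : {x : G | x ∈ S ∨ x⁻¹ ∈ S}.Finite := hfin.union (hfin.preimage inv_injective.injOn)
  have := hT.to_subtype
  refine ((List.finite_length_le {x : G | x ∈ S ∨ x⁻¹ ∈ S} n).image
    fun l => (l.map Subtype.val).prod).subset fun g hg => ?_
  obtain ⟨l, ⟨hl, hp⟩, hn⟩ := exists_word hS g
  lift l to List {x : G | x ∈ S ∨ x⁻¹ ∈ S} using hl
  refine ⟨l, ?_, hp⟩
  rw [List.length_map] at hn
  exact hn.trans_le hg

/-- The powers of an element `a` of infinite order have lengths in every interval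
`[r, r + |a|]`. -/
theorem exists_pow_wordLength (hfin : S.Finite) (hS : Subgroup.closure S = ⊤) {a : G}
    (ha : ¬ IsOfFinOrder a) {r : ℝ} (hr : 0 ≤ r) :
    ∃ k : ℕ, r ≤ wordLength S (a ^ k) ∧ (wordLength S (a ^ k) : ℝ) ≤ r + wordLength S a := by
  classical
  have hex : ∃ k : ℕ, r ≤ wordLength S (a ^ k) := by
    by_contra! h
    refine Set.infinite_range_of_injective (injective_pow_iff_not_isOfFinOrder.2 ha)
      ((finite_wordLength_le hfin hS ⌊r⌋₊).subset ?_)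
    rintro _ ⟨k, rfl⟩
    exact Nat.le_floor (h k).le
  refine ⟨Nat.find hex, Nat.find_spec hex, ?_⟩
  -- The first power of length at least `r` overshoots by at most one factor `a`.
  rcases hk : Nat.find hex with _ | k
  · rw [pow_zero, wordLength_one, Nat.cast_zero]
    positivity
  · have h1 : (wordLength S (a ^ k) : ℝ) < r := not_le.1 (Nat.find_min hex (hk ▸ k.lt_succ_self))
    have h2 : (wordLength S (a ^ (k + 1)) : ℝ) ≤ wordLength S (a ^ k) + wordLength S a := by
      rw [pow_succ]
      exact_mod_cast wordLength_mul_le hS _ _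
    linarith

/-- A central subgroup of infinite index has minimal coset representatives of every length. -/
theorem exists_wordLength_eq_of_not_finiteIndex (hfin : S.Finite) (hS : Subgroup.closure S = ⊤)
    {H : Subgroup G} (hc : H ≤ Subgroup.center G) (hH : ¬ H.FiniteIndex) (m : ℕ) :
    ∃ g : G, wordLength S g = m ∧ ∀ h ∈ H, m ≤ wordLength S (g * h) := by
  -- Finitely many elements are shorter than `m`, so they cannot meet all of the infinitely many
  -- cosets.
  obtain ⟨g₀, hg₀⟩ : ∃ g : G, ∀ h ∈ H, m ≤ wordLength S (g * h) := by
    by_contra! hall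
    refine hH ?_
    have := (finite_wordLength_le hfin hS m).to_subtype
    have : Finite (G ⧸ H) := by
      refine Finite.of_surjective
        (fun g : {g : G | wordLength S g ≤ m} => (g.1 : G ⧸ H)) fun q => ?_
      obtain ⟨g, rfl⟩ := QuotientGroup.mk_surjective q
      obtain ⟨h, hh, hlt⟩ := hall g
      exact ⟨⟨g * h, hlt.le⟩, QuotientGroup.mk_mul_of_mem g hh⟩
    exact Subgroup.finiteIndex_of_finite_quotient
  obtain ⟨h₀, hmin⟩ : ∃ h₀ : H, ∀ h : H, wordLength S (g₀ * h₀) ≤ wordLength S (g₀ * h) :=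
    ⟨Function.argmin (fun h : H => wordLength S (g₀ * h)),
      fun h => Function.argmin_le (fun h : H => wordLength S (g₀ * h)) h⟩
  obtain ⟨u, hu0, hu1, hu⟩ := exists_geodesic hS (g₀ * h₀)
  have hm : m ≤ wordLength S (g₀ * h₀) := hg₀ h₀ h₀.2
  -- As `h` is central, shortening the prefix `u m` within its coset would also shorten `g₀ * h₀`,
  -- which is minimal.
  have hle : ∀ h ∈ H, m ≤ wordLength S (u m * h) := fun h hh => by
    have h1 := hu _ _ hm
    rw [hu1] at h1
    have h2 := wordLength_mul_le hS (u m * h) ((u m)⁻¹ * (g₀ * h₀))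
    have h3 : u m * h * ((u m)⁻¹ * (g₀ * h₀)) = g₀ * (h₀ * h : G) := by
      rw [(Subgroup.mem_center_iff.1 (hc hh) (u m)), mul_assoc h, mul_inv_cancel_left,
        ← Subgroup.mem_center_iff.1 (hc hh), mul_assoc]
    rw [h3] at h2
    have h4 : wordLength S (g₀ * h₀) ≤ wordLength S (g₀ * (h₀ * h : G)) := hmin (h₀ * ⟨h, hh⟩)
    omega
  refine ⟨u m, le_antisymm ?_ ?_, hle⟩
  · simpa [hu0] using hu 0 m m.zero_le
  · simpa using hle 1 H.one_mem

end WordLength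

/-! ### Ultralimits of rescaled groups -/

section Ultralimit

variable {I : Type} {ω : Ultrafilter I} {G : I → Type u} [∀ i, MetricSpace (G i)]
  {d : I → {r : ℝ // 0 < r}} {b : ∀ i, G i}

/-- Sequences in the unscaled spaces which represent points of the ultralimit. -/
def IsFiniteSeq (ω : Ultrafilter I) (d : I → {r : ℝ // 0 < r}) (b x : ∀ i, G i) : Prop :=
  ∃ C : ℝ, ∀ᶠ i in (ω : Filter I), dist (x i) (b i) / (d i : ℝ) ≤ C

/-- The point of the ultralimit represented by a sequence. -/
noncomputable def ultraPoint (x : ∀ i, G i) (hx : IsFiniteSeq ω d b x) : ScaledUltralimit ω G b d :=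
  SeparationQuotient.mk (⟨x, hx⟩ : FiniteSeq ω (fun i => Rescaled (G i) (d i)) _)

theorem exists_ultraPoint (p : ScaledUltralimit ω G b d) :
    ∃ x hx, ultraPoint (ω := ω) (d := d) (b := b) x hx = p := by
  obtain ⟨⟨x, hx⟩, rfl⟩ := SeparationQuotient.surjective_mk p
  exact ⟨x, hx, rfl⟩

theorem tendsto_dist_ultraPoint {x y : ∀ i, G i} (hx : IsFiniteSeq ω d b x)
    (hy : IsFiniteSeq ω d b y) :
    Tendsto (fun i => dist (x i) (y i) / (d i : ℝ)) (ω : Filter I)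
      (𝓝 (dist (ultraPoint x hx) (ultraPoint y hy))) :=
  tendsto_ultraDist (X := fun i => Rescaled (G i) (d i)) ⟨x, hx⟩ ⟨y, hy⟩

theorem IsFiniteSeq.of_dist_le {x y : ∀ i, G i} (hx : IsFiniteSeq ω d b x) {C : ℝ}
    (h : ∀ᶠ i in (ω : Filter I), dist (y i) (x i) / (d i : ℝ) ≤ C) : IsFiniteSeq ω d b y := by
  obtain ⟨C', hC'⟩ := hx
  refine ⟨C + C', ?_⟩
  filter_upwards [h, hC'] with i h1 h2
  calc dist (y i) (b i) / (d i : ℝ) ≤ (dist (y i) (x i) + dist (x i) (b i)) / (d i : ℝ) :=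
        div_le_div_of_nonneg_right (dist_triangle _ _ _) (d i).2.le
    _ ≤ C + C' := by rw [add_div]; exact add_le_add h1 h2

variable [∀ i, Group (G i)] {S : ∀ i, Set (G i)}

/-- Discrete geodesics, sampled at integer times, are geodesic up to an additive error 1, which
vanishes after division by `d i`. -/
theorem hasGeodesics_scaledUltralimit (hS : ∀ i, Subgroup.closure (S i) = ⊤)
    (hdist : ∀ i (x y : G i), dist x y = wordLength (S i) (x⁻¹ * y))
    (hd : ScalingTendsto ω d) : HasGeodesics (ScaledUltralimit ω G b d) := by
  intro p q
  obtain ⟨x, hx, rfl⟩ := exists_ultraPoint p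
  obtain ⟨y, hy, rfl⟩ := exists_ultraPoint q
  have hinv : Tendsto (fun i => 1 / (d i : ℝ)) (ω : Filter I) (𝓝 0) := by
    simp only [one_div]
    exact hd.inv_tendsto_atTop
  have hxy := tendsto_dist_ultraPoint hx hy
  choose u hu0 hu1 hu using fun i => exists_geodesic (hS i) ((x i)⁻¹ * y i)
  let c : ℝ → ∀ i, G i := fun t i => x i * u i ⌊t * dist (x i) (y i)⌋₊
  have hc : ∀ s t i, dist (c s i) (c t i) ≤ |s - t| * dist (x i) (y i) + 1 := by
    intro s t i
    wlog hst : s ≤ t generalizing s t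
    · rw [dist_comm, abs_sub_comm]
      exact this t s (le_of_not_ge hst)
    have hL : 0 ≤ dist (x i) (y i) := dist_nonneg
    have hmono : s * dist (x i) (y i) ≤ t * dist (x i) (y i) := by gcongr
    have hfl := Nat.floor_mono hmono
    have h1 := hu i _ _ hfl
    have h2 : dist (c s i) (c t i) = wordLength (S i)
        ((u i ⌊s * dist (x i) (y i)⌋₊)⁻¹ * u i ⌊t * dist (x i) (y i)⌋₊) := by
      rw [hdist]
      simp only [c]
      congr 2
      group
    rw [h2, abs_sub_comm, abs_of_nonneg (sub_nonneg.2 hst), sub_mul]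
    have h3 : ((⌊t * dist (x i) (y i)⌋₊ - ⌊s * dist (x i) (y i)⌋₊ : ℕ) : ℝ) ≤
        t * dist (x i) (y i) - s * dist (x i) (y i) + 1 := by
      rw [Nat.cast_sub hfl]
      have h4 := Nat.lt_floor_add_one (s * dist (x i) (y i))
      rcases le_total 0 (t * dist (x i) (y i)) with h5 | h5
      · have := Nat.floor_le h5
        linarith
      · rw [Nat.floor_of_nonpos h5]
        have : (0 : ℝ) ≤ (⌊s * dist (x i) (y i)⌋₊ : ℝ) := Nat.cast_nonneg _
        push_cast
        linarith
    exact (Nat.cast_le.2 h1).trans h3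
  have hc0 : c 0 = x := by
    funext i
    simp [c, hu0]
  -- Distances are integers, so the floor at time 1 is the full word length.
  have hc1 : c 1 = y := by
    funext i
    simp [c, hdist, hu1]
  have hlim : ∀ s t : ℝ, Tendsto (fun i => (|s - t| * dist (x i) (y i) + 1) / (d i : ℝ))
      (ω : Filter I) (𝓝 (|s - t| * dist (ultraPoint x hx) (ultraPoint y hy))) := by
    intro s t
    have := (hxy.const_mul |s - t|).add hinv
    rw [add_zero] at this
    refine this.congr fun i => ?_
    rw [add_div, mul_div_assoc]
  have hcfin : ∀ t, IsFiniteSeq ω d b (c t) := fun t => by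
    refine hx.of_dist_le (C := |t - 0| * dist (ultraPoint x hx) (ultraPoint y hy) + 1) ?_
    filter_upwards [(hlim t 0).eventually_lt_const (lt_add_one _)] with i hi
    refine le_trans (div_le_div_of_nonneg_right ?_ (d i).2.le) hi.le
    have := hc t 0 i
    rwa [hc0] at this
  refine ⟨fun t => ultraPoint (c t) (hcfin t), ?_, ?_, fun s t => ?_⟩
  · simp only [hc0]
  · simp only [hc1]
  · exact le_of_tendsto_of_tendsto' (tendsto_dist_ultraPoint _ _) (hlim s t) fun i =>
      div_le_div_of_nonneg_right (hc s t i) (d i).2.le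

/-- The map `φ` of the ultralimit is induced by right multiplication by the sequence `h`. -/
def IsRightMul (φ : ScaledUltralimit ω G b d → ScaledUltralimit ω G b d) (h : ∀ i, G i) : Prop :=
  ∀ x hx, ∃ hxh, φ (ultraPoint x hx) = ultraPoint (fun i => x i * h i) hxh

theorem exists_isRightMul (hdist : ∀ i (x y : G i), dist x y = wordLength (S i) (x⁻¹ * y))
    {h : ∀ i, G i}
    (hh : ∀ i, h i ∈ Subgroup.center (G i)) {C : ℝ}
    (hC : ∀ᶠ i in (ω : Filter I), (wordLength (S i) (h i) : ℝ) / (d i : ℝ) ≤ C) :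
    ∃ φ : ScaledUltralimit ω G b d → ScaledUltralimit ω G b d, Isometry φ ∧ IsRightMul φ h := by
  have hfin : ∀ x : ∀ i, G i, IsFiniteSeq ω d b x → IsFiniteSeq ω d b fun i => x i * h i :=
    fun x hx => hx.of_dist_le (C := C) <| by
      filter_upwards [hC] with i hi
      rwa [dist_comm, hdist, inv_mul_cancel_left]
  -- The map is defined on chosen representatives; `hdd` shows that the choice is irrelevant.
  choose r hr hrp using exists_ultraPoint (ω := ω) (G := G) (b := b) (d := d)
  have hdd : ∀ x y (hx : IsFiniteSeq ω d b x) (hy : IsFiniteSeq ω d b y),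
      dist (ultraPoint (fun i => x i * h i) (hfin x hx))
        (ultraPoint (fun i => y i * h i) (hfin y hy)) =
      dist (ultraPoint x hx) (ultraPoint y hy) := fun x y hx hy => by
    refine tendsto_nhds_unique (tendsto_dist_ultraPoint _ _)
      ((tendsto_dist_ultraPoint hx hy).congr fun i => ?_)
    rw [hdist, hdist, mul_inv_rev, mul_assoc, ← mul_assoc (x i)⁻¹,
      Subgroup.mem_center_iff.1 (hh i), inv_mul_cancel_left]
  refine ⟨fun p => ultraPoint (fun i => r p i * h i) (hfin _ (hr p)),
    Isometry.of_dist_eq fun p q => ?_, fun x hx => ⟨hfin x hx, ?_⟩⟩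
  · rw [hdd _ _ (hr p) (hr q), hrp, hrp]
  · rw [← dist_eq_zero, hdd _ _ (hr _) hx, hrp, dist_self]

/-- An ultralimit of rescaled word metrics on groups which are not virtually cyclic has no
cut-point if there are central elements of infinite order whose length is negligible with respect
to the scaling constants. -/
theorem not_hasCutPoint_scaledUltralimit (hfin : ∀ i, (S i).Finite)
    (hS : ∀ i, Subgroup.closure (S i) = ⊤)
    (hdist : ∀ i (x y : G i), dist x y = wordLength (S i) (x⁻¹ * y))
    (hvc : ∀ i, ¬ VirtuallyCyclic (G i)) {a : ∀ i, G i}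
    (hac : ∀ i, a i ∈ Subgroup.center (G i)) (ha : ∀ i, ¬ IsOfFinOrder (a i))
    (hd : ScalingTendsto ω d)
    (had : Tendsto (fun i => (wordLength (S i) (a i) : ℝ) / (d i : ℝ)) (ω : Filter I) (𝓝 0)) :
    ¬ HasCutPoint (ScaledUltralimit ω G b d) := by
  have hb : IsFiniteSeq ω d b b := ⟨0, by simp⟩
  have : Nonempty (ScaledUltralimit ω G b d) := ⟨ultraPoint b hb⟩
  have hzc : ∀ i, Subgroup.zpowers (a i) ≤ Subgroup.center (G i) := fun i => by
    simpa using hac i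
  refine not_hasCutPoint_of_displacements (hasGeodesics_scaledUltralimit hS hdist hd)
    {φ | Isometry φ ∧ ∃ h : ∀ i, G i, (∀ i, h i ∈ Subgroup.zpowers (a i)) ∧
      (∃ C : ℝ, ∀ᶠ i in (ω : Filter I), (wordLength (S i) (h i) : ℝ) / (d i : ℝ) ≤ C) ∧
      IsRightMul φ h} (fun φ hφ => hφ.1) ?_ ?_ ?_
  · rintro φ ⟨-, h, hh, ⟨C, hC⟩, hφ⟩
    have hC' : ∀ᶠ i in (ω : Filter I), (wordLength (S i) (h i)⁻¹ : ℝ) / (d i : ℝ) ≤ C := by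
      filter_upwards [hC] with i hi
      rwa [wordLength_inv (hS i)]
    have hh' : ∀ i, (h i)⁻¹ ∈ Subgroup.zpowers (a i) := fun i => inv_mem (hh i)
    obtain ⟨ψ, hψ, hψh⟩ := exists_isRightMul (b := b) hdist (fun i => hzc i (hh' i)) hC'
    refine ⟨ψ, ⟨hψ, _, hh', ⟨C, hC'⟩, hψh⟩, fun p => ?_, fun p => ?_⟩
    · obtain ⟨x, hx, rfl⟩ := exists_ultraPoint p
      obtain ⟨hx', e⟩ := hψh x hx
      obtain ⟨hx'', e'⟩ := hφ _ hx'
      rw [e, e']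
      simp only [inv_mul_cancel_right]
    · obtain ⟨x, hx, rfl⟩ := exists_ultraPoint p
      obtain ⟨hx', e⟩ := hφ x hx
      obtain ⟨hx'', e'⟩ := hψh _ hx'
      rw [e, e']
      simp only [mul_inv_cancel_right]
  · intro r hr
    choose k hk1 hk2 using fun i =>
      exists_pow_wordLength (hfin i) (hS i) (ha i) (mul_nonneg hr.le (d i).2.le)
    have hlim : Tendsto (fun i => (wordLength (S i) (a i ^ k i) : ℝ) / (d i : ℝ))
        (ω : Filter I) (𝓝 r) := by
      have hup := had.const_add r
      rw [add_zero] at hup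
      refine tendsto_of_tendsto_of_tendsto_of_le_of_le tendsto_const_nhds hup
        (fun i => (le_div_iff₀ (d i).2).2 (hk1 i)) fun i => ?_
      have h0 := (d i).2
      calc _ ≤ (r * (d i : ℝ) + wordLength (S i) (a i)) / (d i : ℝ) :=
            div_le_div_of_nonneg_right (hk2 i) h0.le
        _ = _ := by rw [add_div, mul_div_cancel_right₀ _ h0.ne']
    have hmem : ∀ i, a i ^ k i ∈ Subgroup.zpowers (a i) := fun i =>
      Subgroup.npow_mem_zpowers _ _
    have hC : ∀ᶠ i in (ω : Filter I),
        (wordLength (S i) (a i ^ k i) : ℝ) / (d i : ℝ) ≤ r + 1 :=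
      (hlim.eventually_lt_const (lt_add_one r)).mono fun _ => le_of_lt
    obtain ⟨φ, hφ, hφh⟩ := exists_isRightMul (b := b) hdist (fun i => hzc i (hmem i)) hC
    refine ⟨φ, ⟨hφ, _, hmem, ⟨_, hC⟩, hφh⟩, fun p => ?_⟩
    obtain ⟨x, hx, rfl⟩ := exists_ultraPoint p
    obtain ⟨hx', e⟩ := hφh x hx
    rw [e]
    refine tendsto_nhds_unique (tendsto_dist_ultraPoint _ _) (hlim.congr fun i => ?_)
    rw [hdist, inv_mul_cancel_left]
  · intro p ε hε
    obtain ⟨x, hx, rfl⟩ := exists_ultraPoint p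
    -- Minimality in the coset keeps `x * g` at rescaled distance at least `ε` from every `x * h`
    -- with `h` a sequence of powers of `a`.
    choose g hg1 hg2 using fun i =>
      exists_wordLength_eq_of_not_finiteIndex (hfin i) (hS i) (hzc i)
        (fun hidx => hvc i ⟨_, inferInstance, hidx⟩) ⌈ε * (d i : ℝ)⌉₊
    have hlim : Tendsto (fun i => (wordLength (S i) (g i) : ℝ) / (d i : ℝ))
        (ω : Filter I) (𝓝 ε) := by
      simp only [hg1]
      exact (tendsto_nat_ceil_mul_div_atTop hε.le).comp hd
    have hxg : IsFiniteSeq ω d b fun i => x i * g i := hx.of_dist_le (C := ε + 1) <| by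
      filter_upwards [hlim.eventually_lt_const (lt_add_one ε)] with i hi
      rw [dist_comm, hdist, inv_mul_cancel_left]
      exact hi.le
    have hdε : dist (ultraPoint x hx) (ultraPoint _ hxg) = ε := by
      refine tendsto_nhds_unique (tendsto_dist_ultraPoint _ _) (hlim.congr fun i => ?_)
      rw [hdist, inv_mul_cancel_left]
    refine ⟨ultraPoint _ hxg, ?_, hdε.le, ?_⟩
    · intro heq
      rw [heq, dist_self] at hdε
      exact hε.ne hdε
    · rintro φ ⟨-, h, hh, -, hφ⟩ heq
      obtain ⟨hxh, e⟩ := hφ x hx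
      rw [e] at heq
      have hle : ε ≤ dist (ultraPoint (fun i => x i * h i) hxh) (ultraPoint _ hxg) := by
        refine ge_of_tendsto' (tendsto_dist_ultraPoint _ _) fun i => ?_
        rw [le_div_iff₀ (d i).2, hdist, mul_inv_rev, mul_assoc, inv_mul_cancel_left,
          ← Subgroup.mem_center_iff.1 (inv_mem (hzc i (hh i)))]
        exact (Nat.le_ceil _).trans (Nat.cast_le.2 (hg2 i _ (inv_mem (hh i))))
      rw [heq, dist_self] at hle
      linarith

end Ultralimit

/-! ### Wideness and uniform unconstrictedness -/

theorem HasCentralInfiniteCyclic.exists_not_isOfFinOrder {G : Type u} [Group G]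
    (h : HasCentralInfiniteCyclic G) : ∃ a ∈ Subgroup.center G, ¬ IsOfFinOrder a := by
  obtain ⟨H, hc, hcyc, hinf⟩ := h
  obtain ⟨a, ha⟩ := (Subgroup.isCyclic_iff_exists_zpowers_eq_top H).1 hcyc
  subst ha
  exact ⟨a, hc (Subgroup.mem_zpowers a), fun hfin =>
    (Set.infinite_coe_iff.1 hinf) (finite_zpowers.2 hfin)⟩

theorem wideGroup_of_hasCentralInfiniteCyclic {G : Type u} [Group G] (hvc : ¬ VirtuallyCyclic G)
    (hG : HasCentralInfiniteCyclic G) : WideGroup G := by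
  intro S hfin hS I _ ω _ d hd e
  obtain ⟨a, hac, ha⟩ := hG.exists_not_isOfFinOrder
  let _ : MetricSpace G := wordMetric S hS
  exact not_hasCutPoint_scaledUltralimit (G := fun _ => G) (S := fun _ => S) (a := fun _ => a)
    (fun _ => hfin) (fun _ => hS) (fun _ _ _ => rfl) (fun _ => hvc) (fun _ => hac) (fun _ => ha)
    hd (hd.const_div_atTop _)

theorem nonPrincipal_hyperfilter (I : Type) [Infinite I] : NonPrincipal (hyperfilter I) :=
  fun _ hs => Set.Finite.notMem_hyperfilter hs

theorem uniformlyUnconstricted_centralFamily : UniformlyUnconstricted centralFamily.{u} := by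
  intro I _ _ B hB
  choose G hG S hfin hS hvc hcen hBeq using hB
  obtain rfl : B = fun i => @MetricSp.mk (G i) (wordMetric (S i) (hS i)) := funext hBeq
  choose a hac ha using fun i => (hcen i).exists_not_isOfFinOrder
  obtain ⟨f, hf⟩ := exists_injective_nat I
  -- The first factor absorbs `|a i|`; the second tends to infinity because `f` is injective, so `|a
  -- i| / d i ≤ 1 / (1 + f i) → 0`.
  let d : I → {r : ℝ // 0 < r} := fun i =>
    ⟨(1 + wordLength (S i) (a i)) * (1 + f i), by positivity⟩
  have hf1 : Tendsto (fun i => (1 + f i : ℝ)) (hyperfilter I : Filter I) atTop := by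
    refine tendsto_atTop_add_const_left _ _ (tendsto_natCast_atTop_atTop.comp ?_)
    have := hf.tendsto_cofinite
    rw [Nat.cofinite_eq_atTop] at this
    exact this.mono_left hyperfilter_le_cofinite
  have hd : ScalingTendsto (hyperfilter I) d := by
    refine tendsto_atTop_mono (fun i => ?_) hf1
    exact le_mul_of_one_le_left (by positivity) (by simp)
  refine ⟨hyperfilter I, nonPrincipal_hyperfilter I, d, hd, fun b => ?_⟩
  let _ : ∀ i, MetricSpace (G i) := fun i => wordMetric (S i) (hS i)
  refine not_hasCutPoint_scaledUltralimit (G := G) (S := S) (a := a) hfin hS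
    (fun _ _ _ => rfl) hvc hac ha hd ?_
  refine squeeze_zero (fun i => div_nonneg (Nat.cast_nonneg _) (d i).2.le) (fun i => ?_)
    hf1.inv_tendsto_atTop
  rw [div_le_iff₀ (d i).2]
  have h1 : (0 : ℝ) < 1 + f i := by positivity
  simp only [d, Pi.inv_apply]
  rw [mul_comm (1 + (wordLength (S i) (a i) : ℝ)), inv_mul_cancel_left₀ h1.ne']
  linarith

end AsympCone

theorem mainTheorem11 :
    (∀ (G : Type u) [Group G], Group.FG G → ¬ AsympCone.VirtuallyCyclic G →
      AsympCone.HasCentralInfiniteCyclic G → AsympCone.WideGroup G) ∧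
    AsympCone.UniformlyUnconstricted AsympCone.centralFamily.{u} :=
  ⟨fun _ _ _ hvc hG => AsympCone.wideGroup_of_hasCentralInfiniteCyclic hvc hG,
    AsympCone.uniformlyUnconstricted_centralFamily⟩
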